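/- Let $\Gamma$ be a finite simple graph and let $W=W_\Gamma$ be the right-angled Coxeter group with defining graph $\Gamma$ (one generator of order $2$ for each vertex; two generators commute if they are adjacent; no further relations). Its abelianization $W^{\mathrm{ab}}$ is a vector space over $\mathbb{Z}/2\mathbb{Z}$; write $\overline{g}$ for the image of $g\in W$. Let $\mathrm{Inv}[W]$ be the graph whose vertices are the conjugacy classes of involutions (elements of order $2$) of $W$, two distinct classes being adjacent when they have commuting representatives. For a vertex $v$, the image $\overline{v}\in W^{\mathrm{ab}}$ of any representative of $v$ is well defined. Let $\mathrm{St}(v)$ be the set consisting of $v$ and its neighbours in $\mathrm{Inv}[W]$; write $[v]=\{u : \mathrm{St}(u)=\mathrm{St}(v)\}$, order these equivalence classes by $[v]\le[w]$ iff $\mathrm{St}(v)\subseteq\mathrm{St}(w)$, and put $S_w=\bigcup_{[v]\ge[w]}[v]$. The collapsing procedure on $\mathrm{Inv}[W]$ starts with $V=\emptyset$ and repeats the following step 2 until all classes have been considered: take a class $[w]$ which has not been considered yet and such that all classes $[v]>[w]$ have been considered; let $|S_w|=2^k-1$ and $k'=|S_w\cap V|$; choose $k-k'$ vertices of $[w]$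 and add them to $V$. Call a (partial) run of the procedure \emph{independent} if after each step 2, considering a class $[w]$, the images $\overline{v}$ of the vertices $v\in V\cap S_w$ are linearly independent in $W^{\mathrm{ab}}$ (as a family indexed by $V\cap S_w$). Then: (1) After any partial independent run, and for every class $[w]$ that may be considered next, $|S_w|$ is of the form $2^k-1$, $k'\le k$, and step 2 can be carried out so that the images $\overline{v}$ of all vertices $v$ of the enlarged set $V$ are linearly independent in $W^{\mathrm{ab}}$. Every partial independent run can be continued to an independent run that considers all classes. (2) After any partial independent run, the images $\overline{v}$, $v\in V$, are linearly independent in $W^{\mathrm{ab}}$. Consequently the chosen elements satisfy no non-trivial product relation: whatever representatives of the classes $v\in V$ are taken, no product of these representatives in which at least one of them occurs an odd number of times is equal to $1$. (3) At the end of any complete independent run, the images $\overline{v}$, $v\in V$, form a basis of $W^{\mathrm{ab}}$, and $V$ is the image of a right-angled Coxeter generating set: there is a right-angled Coxeter system $(W,\{s_v\}_{v\in V})$, with generators indexed by $V$, such that $s_v\in v$, and hence $\overline{s_v}=\overline{v}$, for every $v\in V$. -/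

import Mathlib

/-! ### Right-angled Coxeter groups -/

/-- The Coxeter matrix of the defining graph `Γ`: adjacent generators commute (`m = 2`), and
non-adjacent distinct generators satisfy no relation (`m = ∞`, encoded as `0`). -/
noncomputable def raMatrix {B : Type*} (Γ : SimpleGraph B) : CoxeterMatrix B where
  M := Matrix.of fun i j => open Classical in if i = j then 1 else if Γ.Adj i j then 2 else 0
  isSymm := by
    ext i j
    by_cases h : i = j
    · simp [h]
    · by_cases h' : Γ.Adj i j
      · simp [h, Ne.symm h, h', h'.symm]
      · simp [h, Ne.symm h, h', mt SimpleGraph.Adj.symm h']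
  diagonal i := by simp
  off_diagonal i j h := by
    simp only [Matrix.of_apply, if_neg h]
    split_ifs <;> simp

/-- The right-angled Coxeter group `W_Γ`. -/
abbrev RACG {B : Type*} (Γ : SimpleGraph B) : Type _ := (raMatrix Γ).Group

theorem two_nsmul_abelianization_racg {B : Type*} (Γ : SimpleGraph B)
    (x : Additive (Abelianization (RACG Γ))) : 2 • x = 0 := by
  have h : ((powMonoidHom 2).comp Abelianization.of : RACG Γ →* Abelianization (RACG Γ)) = 1 := by
    refine (raMatrix Γ).toCoxeterSystem.ext_simple fun i => ?_
    rw [MonoidHom.comp_apply, powMonoidHom_apply, ← map_pow, CoxeterSystem.simple_sq, map_one,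
      MonoidHom.one_apply]
  induction x using Additive.rec with
  | ofMul y =>
    obtain ⟨g, rfl⟩ := QuotientGroup.mk_surjective y
    exact congrArg Additive.ofMul (DFunLike.congr_fun h g)

/-- The abelianization of `W_Γ`, written additively, as a vector space over `ℤ/2ℤ`. -/
noncomputable instance {B : Type*} (Γ : SimpleGraph B) :
    Module (ZMod 2) (Additive (Abelianization (RACG Γ))) :=
  AddCommGroup.zmodModule (two_nsmul_abelianization_racg Γ)

/-! ### The involution graph -/

/-- Conjugacy classes of involutions of `G`. -/
def InvClass (G : Type*) [Group G] : Type _ :=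
  {c : ConjClasses G // ∃ g : G, orderOf g = 2 ∧ ConjClasses.mk g = c}

/-- The involution graph `Inv[G]` (without loops): two distinct classes are adjacent if they have
commuting representatives. -/
def invGraph (G : Type*) [Group G] : SimpleGraph (InvClass G) where
  Adj x y := x ≠ y ∧ ∃ g h : G, ConjClasses.mk g = x.1 ∧ ConjClasses.mk h = y.1 ∧ Commute g h
  symm := ⟨fun _ _ ⟨hne, g, h, hg, hh, hc⟩ => ⟨hne.symm, h, g, hh, hg, hc.symm⟩⟩
  loopless := ⟨fun _ h => h.1 rfl⟩

/-- The common image in the abelianization of the elements of a class of involutions. -/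
noncomputable def abImage {G : Type*} [Group G] (x : InvClass G) : Additive (Abelianization G) :=
  Additive.ofMul (Quotient.lift (fun g : G => Abelianization.of g)
    (fun _ _ hab => isConj_iff_eq.mp (Abelianization.of.map_isConj hab)) x.1)

/-! ### The star poset and the collapsing procedure -/

/-- The star of a vertex: the vertex together with its neighbours. -/
def vertexStar {V : Type*} (G : SimpleGraph V) (v : V) : Set V := insert v (G.neighborSet v)

/-- Two vertices are star-equivalent if their stars are equal. -/
def starSetoid {V : Type*} (G : SimpleGraph V) : Setoid V := Setoid.ker (vertexStar G)

/-- The star-equivalence classes of vertices. -/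
def StarPoset {V : Type*} (G : SimpleGraph V) : Type _ := Quotient (starSetoid G)

/-- The class `[v]` of a vertex. -/
def starClass {V : Type*} (G : SimpleGraph V) (v : V) : StarPoset G := Quotient.mk (starSetoid G) v

/-- The common star of the vertices of a class. -/
def StarPoset.star {V : Type*} {G : SimpleGraph V} (c : StarPoset G) : Set V :=
  Quotient.lift (vertexStar G) (fun _ _ h => h) c

theorem StarPoset.star_injective {V : Type*} (G : SimpleGraph V) :
    Function.Injective (StarPoset.star (G := G)) := by
  intro a b h
  induction a using Quotient.inductionOn
  induction b using Quotient.inductionOn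
  exact Quotient.sound h

/-- `[v] ≤ [w]` if the star of `v` is contained in the star of `w`. -/
instance {V : Type*} (G : SimpleGraph V) : PartialOrder (StarPoset G) :=
  PartialOrder.lift StarPoset.star (StarPoset.star_injective G)

/-- The clique above `c`: the union of all classes `≥ c`. -/
def cliqueAbove {V : Type*} {G : SimpleGraph V} (c : StarPoset G) : Set V :=
  {v | c ≤ starClass G v}

/-- A state of the collapsing procedure: the classes already considered, and the vertices chosen so
far. -/
@[ext] structure CollapseState {V : Type*} (G : SimpleGraph V) where
  considered : Set (StarPoset G)
  chosen : Set V

/-- The initial state: nothing is considered, nothing is chosen. -/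
def CollapseState.initial {V : Type*} (G : SimpleGraph V) : CollapseState G := ⟨∅, ∅⟩

/-- The class `w` may be considered next: it has not been considered yet, and all strictly larger
classes have. -/
def CollapseState.IsNext {V : Type*} {G : SimpleGraph V} (s : CollapseState G)
    (w : StarPoset G) : Prop :=
  w ∉ s.considered ∧ ∀ v, w < v → v ∈ s.considered

/-- `C` is a legal choice of vertices when `w` is considered in the state `s`: it consists of
`k - k'` vertices of the class `w`, where the clique above `w` has `2 ^ k - 1` vertices, `k'` of
which are already chosen. -/
def CollapseState.IsChoice {V : Type*} {G : SimpleGraph V} (s : CollapseState G)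
    (w : StarPoset G) (C : Set V) : Prop :=
  (∀ v ∈ C, starClass G v = w) ∧
    ∃ k : ℕ, (cliqueAbove w).encard + 1 = 2 ^ k ∧ (cliqueAbove w ∩ s.chosen).encard + C.encard = k

/-- The state after `w` has been considered and the vertices in `C` have been chosen. -/
def CollapseState.update {V : Type*} {G : SimpleGraph V} (s : CollapseState G)
    (w : StarPoset G) (C : Set V) : CollapseState G :=
  ⟨insert w s.considered, s.chosen ∪ C⟩

/-- The procedure is over when all classes have been considered. -/
def CollapseState.IsFinal {V : Type*} {G : SimpleGraph V} (s : CollapseState G) : Prop :=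
  s.considered = Set.univ

/-- One pass through step 2 of the collapsing procedure for `Inv[W_Γ]`, in which the new vertices
are chosen so that the chosen vertices in the clique above `w` have linearly independent images in
the abelianization. -/
def IndepStep {B : Type*} (Γ : SimpleGraph B) (s t : CollapseState (invGraph (RACG Γ))) : Prop :=
  ∃ w C, s.IsNext w ∧ s.IsChoice w C ∧
    LinearIndepOn (ZMod 2) abImage (cliqueAbove w ∩ (s.chosen ∪ C)) ∧ t = s.update w C

/-- `s` is reached from the initial state by finitely many such passes. -/
def IndepReachable {B : Type*} (Γ : SimpleGraph B) (s : CollapseState (invGraph (RACG Γ))) : Prop :=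
  Relation.ReflTransGen (IndepStep Γ) (CollapseState.initial _) s

open Classical in
/-- The elements `r v`, `v ∈ S`, of a group satisfy a non-trivial product relation: some product of
them equals `1` although one of them occurs in it an odd number of times. -/
def HasProductRelation {ι G : Type*} [Group G] (r : ι → G) (S : Set ι) : Prop :=
  ∃ L : List ι, (∀ v ∈ L, v ∈ S) ∧ (∃ v, Odd (L.count v)) ∧ (L.map r).prod = 1

/-! Up to conjugacy, the involutions of `W_Γ` are the products over non-empty cliques of `Γ`
(`exists_isConj_wordProd`). Such a product is recovered from its image in the abelianization, which
is the `ZMod 2`-space on the vertices. So a class of involutions is a non-zero vector with clique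
support (`classVector_spec`, `classVector_injective`). Two classes have commuting representatives
iff the union of their supports is a clique (`mem_vertexStar_iff`), as infinite dihedral quotients
show. Hence the clique above a star class `c`, with `0` added, is the coordinate subspace of a
clique `baseClique c` of `Γ`, and this gives the cardinality `2 ^ k - 1`.

The procedure is then linear algebra, governed by the invariant `IsGood`. In it, `k'` counts the
considered vertices of `baseClique w`, so `k - k'` counts the vertices of `Γ` of class `w`.
Independence inside the clique above `w` becomes spanning of its coordinate subspace, by dimension.
These local spans together span the coordinate space of all considered vertices, and counting turns
this into global independence.

At the end, the chosen classes match the vertices of `Γ` by a bijection preserving star classes. The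
induced linear map preserves every coordinate subspace above, so it lifts to an automorphism of
`W_Γ` (`cliqueEquiv`), which carries the standard generators to representatives of the chosen
classes. -/

/-! ### Right-angled Coxeter groups: lifting homomorphisms -/

/-- The canonical Coxeter system on a right-angled Coxeter group. -/
noncomputable def racgSystem {B : Type*} (Γ : SimpleGraph B) :
    CoxeterSystem (raMatrix Γ) (RACG Γ) := (raMatrix Γ).toCoxeterSystem

/-- Two vertices are compatible if they are equal or adjacent. -/
def Compat {B : Type*} (Γ : SimpleGraph B) (a b : B) : Prop := a = b ∨ Γ.Adj a b

theorem Compat.symm {B : Type*} {Γ : SimpleGraph B} {a b : B} (h : Compat Γ a b) :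
    Compat Γ b a :=
  h.imp Eq.symm SimpleGraph.Adj.symm

theorem isLiftable_raMatrix {B G : Type*} [Group G] {Γ : SimpleGraph B} {f : B → G}
    (hsq : ∀ b, f b * f b = 1) (hcomm : ∀ a b, Γ.Adj a b → Commute (f a) (f b)) :
    (raMatrix Γ).IsLiftable f := by
  intro a b
  by_cases h : a = b
  · subst h; simp [hsq]
  · by_cases h' : Γ.Adj a b
    · have : raMatrix Γ a b = 2 := by simp [raMatrix, h, h']
      rw [this, (hcomm a b h').mul_pow, pow_two, pow_two, hsq, hsq, one_mul]
    · have : raMatrix Γ a b = 0 := by simp [raMatrix, h, h']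
      rw [this, pow_zero]

theorem commute_simple {B : Type*} {Γ : SimpleGraph B} {a b : B} (h : Compat Γ a b) :
    Commute ((racgSystem Γ).simple a) ((racgSystem Γ).simple b) := by
  rcases h with rfl | h
  · exact Commute.refl _
  · have h2 := (racgSystem Γ).simple_mul_simple_pow a b
    have : raMatrix Γ a b = 2 := by simp [raMatrix, h, h.ne]
    rw [this, pow_two] at h2
    have h3 := eq_inv_of_mul_eq_one_left h2
    rwa [mul_inv_rev, CoxeterSystem.inv_simple, CoxeterSystem.inv_simple] at h3

open Classical in
/-- The retraction of `W_Γ` onto the infinite dihedral group generated by two non-adjacent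
vertices. -/
noncomputable def toDihedral {B : Type*} {Γ : SimpleGraph B} {a b : B} (h : ¬ Compat Γ a b) :
    RACG Γ →* DihedralGroup 0 :=
  (racgSystem Γ).lift ⟨fun c => if c = a then .sr 0 else if c = b then .sr 1 else 1,
    isLiftable_raMatrix (fun c => by split_ifs <;> simp) (fun c d hcd => by
      have hab : ¬ Γ.Adj a b := fun h' => h (Or.inr h')
      have hba : ¬ Γ.Adj b a := fun h' => h (Or.inr h'.symm)
      by_cases hca : c = a <;> by_cases hda : d = a <;> by_cases hcb : c = b <;>
        by_cases hdb : d = b <;> simp_all)⟩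

theorem toDihedral_left {B : Type*} {Γ : SimpleGraph B} {a b : B} (h : ¬ Compat Γ a b) :
    toDihedral h ((racgSystem Γ).simple a) = .sr 0 := by
  simp [toDihedral]

theorem toDihedral_right {B : Type*} {Γ : SimpleGraph B} {a b : B} (h : ¬ Compat Γ a b) :
    toDihedral h ((racgSystem Γ).simple b) = .sr 1 := by
  have : b ≠ a := fun e => h (Or.inl e.symm)
  simp [toDihedral, this]

theorem toDihedral_of_ne {B : Type*} {Γ : SimpleGraph B} {a b c : B} (h : ¬ Compat Γ a b)
    (ha : c ≠ a) (hb : c ≠ b) : toDihedral h ((racgSystem Γ).simple c) = 1 := by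
  simp [toDihedral, ha, hb]

/-! ### The inversion cocycle and the exchange condition -/

section Exchange

variable {B : Type*} {Γ : SimpleGraph B}

open Classical in
/-- The action of a generator on `W × ℤ/2ℤ` that records inversions. -/
noncomputable def inversionPerm (Γ : SimpleGraph B) (b : B) : Equiv.Perm (RACG Γ × ZMod 2) :=
  Function.Involutive.toPerm
    (fun p => ((racgSystem Γ).simple b * p.1 * (racgSystem Γ).simple b,
      p.2 + if p.1 = (racgSystem Γ).simple b then 1 else 0))
    (fun p => by
      have h : (racgSystem Γ).simple b * p.1 * (racgSystem Γ).simple b = (racgSystem Γ).simple b ↔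
          p.1 = (racgSystem Γ).simple b := by
        rw [mul_eq_right, mul_eq_one_iff_inv_eq, CoxeterSystem.inv_simple, eq_comm]
      ext1
      · simp only [mul_assoc, CoxeterSystem.simple_mul_simple_self, mul_one,
          CoxeterSystem.simple_mul_simple_cancel_left]
      · simp only [h, add_assoc, CharTwo.add_self_eq_zero, add_zero])

open Classical in
theorem inversionPerm_apply (b : B) (x : RACG Γ) (e : ZMod 2) :
    inversionPerm Γ b (x, e) = ((racgSystem Γ).simple b * x * (racgSystem Γ).simple b,
      e + if x = (racgSystem Γ).simple b then 1 else 0) := rfl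

/-- Conjugation by either generator fixes the other one, so neither indicator term depends on which
permutation is applied first. -/
theorem inversionPerm_commute {a b : B} (h : Γ.Adj a b) :
    Commute (inversionPerm Γ a) (inversionPerm Γ b) := by
  have hc := commute_simple (Γ := Γ) (Or.inr h)
  have key : ∀ {a b : B}, Commute ((racgSystem Γ).simple a) ((racgSystem Γ).simple b) →
      ∀ x, (racgSystem Γ).simple b * x * (racgSystem Γ).simple b = (racgSystem Γ).simple a ↔
        x = (racgSystem Γ).simple a := by
    intro a b hc x
    constructor
    · intro h
      have : x = (racgSystem Γ).simple b * ((racgSystem Γ).simple b * x * (racgSystem Γ).simple b)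
          * (racgSystem Γ).simple b := by
        simp only [mul_assoc, CoxeterSystem.simple_mul_simple_self, mul_one,
          CoxeterSystem.simple_mul_simple_cancel_left]
      rw [this, h, ← hc.eq, mul_assoc, CoxeterSystem.simple_mul_simple_self, mul_one]
    · rintro rfl
      rw [← hc.eq, mul_assoc, CoxeterSystem.simple_mul_simple_self, mul_one]
  refine Equiv.ext fun ⟨x, e⟩ => ?_
  rw [Equiv.Perm.mul_apply, Equiv.Perm.mul_apply, inversionPerm_apply, inversionPerm_apply,
    inversionPerm_apply, inversionPerm_apply]
  have h1 := propext (key hc x)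
  have h2 := propext (key hc.symm x)
  dsimp only
  rw [h1, h2]
  ext1
  · simp only [← mul_assoc]
    rw [hc.eq, mul_assoc _ ((racgSystem Γ).simple a) ((racgSystem Γ).simple b), hc.eq, ← mul_assoc]
  · exact add_right_comm e _ _

/-- The action of `W_Γ` on `W_Γ × ℤ/2ℤ` that records inversions. -/
noncomputable def inversionAction (Γ : SimpleGraph B) :
    RACG Γ →* Equiv.Perm (RACG Γ × ZMod 2) :=
  (racgSystem Γ).lift ⟨inversionPerm Γ, isLiftable_raMatrix
    (fun b => Equiv.ext fun p => (inversionPerm Γ b).left_inv p)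
    (fun _ _ => inversionPerm_commute)⟩

/-- The parity of the number of times `x` occurs in the right inversion sequence of a word
for `w`. -/
noncomputable def invParity (w x : RACG Γ) : ZMod 2 := (inversionAction Γ w (x, 0)).2

theorem inversionAction_apply (w x : RACG Γ) (e : ZMod 2) :
    inversionAction Γ w (x, e) = (w * x * w⁻¹, e + invParity w x) := by
  suffices h : ∃ n : RACG Γ → ZMod 2, ∀ x e,
      inversionAction Γ w (x, e) = (w * x * w⁻¹, e + n x) by
    obtain ⟨n, hn⟩ := h
    rw [invParity, hn, hn, zero_add]
  refine (racgSystem Γ).simple_induction (p := fun w => ∃ n : RACG Γ → ZMod 2,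
    ∀ x e, inversionAction Γ w (x, e) = (w * x * w⁻¹, e + n x)) w (fun b => ?_) ?_ ?_
  · classical
    refine ⟨fun x => if x = (racgSystem Γ).simple b then 1 else 0, fun x e => ?_⟩
    rw [inversionAction, CoxeterSystem.lift_apply_simple, inversionPerm_apply,
      CoxeterSystem.inv_simple]
  · exact ⟨0, by simp⟩
  · rintro v w ⟨m, hm⟩ ⟨n, hn⟩
    refine ⟨fun x => n x + m (w * x * w⁻¹), fun x e => ?_⟩
    rw [map_mul, Equiv.Perm.mul_apply, hn, hm]
    simp [mul_assoc, add_assoc]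

theorem invParity_mul (v w x : RACG Γ) :
    invParity (v * w) x = invParity w x + invParity v (w * x * w⁻¹) := by
  conv_lhs => rw [invParity, map_mul, Equiv.Perm.mul_apply, inversionAction_apply,
    inversionAction_apply, zero_add]

open Classical in
theorem invParity_simple (b : B) (x : RACG Γ) :
    invParity ((racgSystem Γ).simple b) x = if x = (racgSystem Γ).simple b then 1 else 0 := by
  rw [invParity, inversionAction, CoxeterSystem.lift_apply_simple, inversionPerm_apply, zero_add]

theorem invParity_one (x : RACG Γ) : invParity 1 x = 0 := by
  simp [invParity]

-- Since `invParity` depends only on the group element, so does the parity of this count. A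
-- reflection counted an odd number of times must therefore occur in every word's inversion
-- sequence.
open Classical in
theorem invParity_wordProd (ω : List B) (x : RACG Γ) :
    invParity ((racgSystem Γ).wordProd ω) x = (((racgSystem Γ).rightInvSeq ω).count x : ℕ) := by
  induction ω with
  | nil => simp [invParity_one]
  | cons b ω ih =>
    rw [CoxeterSystem.wordProd_cons, invParity_mul, ih, invParity_simple,
      CoxeterSystem.rightInvSeq, List.count_cons]
    have : (racgSystem Γ).wordProd ω * x * ((racgSystem Γ).wordProd ω)⁻¹ = (racgSystem Γ).simple b ↔
        ((racgSystem Γ).wordProd ω)⁻¹ * (racgSystem Γ).simple b * (racgSystem Γ).wordProd ω = x := by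
      rw [mul_inv_eq_iff_eq_mul, mul_assoc, inv_mul_eq_iff_eq_mul, eq_comm]
    simp [this]

theorem mem_rightInvSeq_of_invParity_ne_zero {ω : List B} {x : RACG Γ}
    (h : invParity ((racgSystem Γ).wordProd ω) x ≠ 0) : x ∈ (racgSystem Γ).rightInvSeq ω := by
  classical
  by_contra hx
  exact h (by rw [invParity_wordProd, List.count_eq_zero_of_not_mem hx, Nat.cast_zero])

/-- Some reduced word for `w` ends in `b`. Its inversion sequence contains the generator as last
term and has no repetitions, so the count is exactly one. -/
theorem invParity_simple_of_isRightDescent {w : RACG Γ} {b : B}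
    (h : (racgSystem Γ).IsRightDescent w b) : invParity w ((racgSystem Γ).simple b) = 1 := by
  classical
  obtain ⟨ω, hω, hw⟩ := (racgSystem Γ).exists_isReduced (w * (racgSystem Γ).simple b)
  have hw' : w = (racgSystem Γ).wordProd (ω.concat b) := by
    rw [CoxeterSystem.wordProd_concat, ← hw, CoxeterSystem.simple_mul_simple_cancel_right]
  have hred : (racgSystem Γ).IsReduced (ω.concat b) := by
    rw [CoxeterSystem.IsReduced, ← hw', List.length_concat, ← hω, ← hw]
    exact ((racgSystem Γ).isRightDescent_iff.mp h).symm
  rw [hw', invParity_wordProd, List.count_eq_one_of_mem hred.nodup_rightInvSeq, Nat.cast_one]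
  rw [CoxeterSystem.rightInvSeq_concat]
  simp

/-- The exchange condition. -/
theorem exists_eraseIdx_of_isRightDescent {ω : List B} {b : B}
    (h : (racgSystem Γ).IsRightDescent ((racgSystem Γ).wordProd ω) b) :
    ∃ j < ω.length, (racgSystem Γ).wordProd ω * (racgSystem Γ).simple b =
      (racgSystem Γ).wordProd (ω.eraseIdx j) := by
  have hmem : (racgSystem Γ).simple b ∈ (racgSystem Γ).rightInvSeq ω :=
    mem_rightInvSeq_of_invParity_ne_zero (by rw [invParity_simple_of_isRightDescent h]; simp)
  obtain ⟨j, hj, hjb⟩ := List.mem_iff_getElem.mp hmem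
  refine ⟨j, by simpa using hj, ?_⟩
  rw [← CoxeterSystem.wordProd_mul_getD_rightInvSeq, List.getD_eq_getElem _ 1 hj, hjb]

/-! ### Involutions are conjugate to products over cliques -/

/-- As `g` is its own inverse, `b` is also a left descent, so `g` has a reduced word starting with
`b`; the exchange condition is applied to that word. -/
theorem commute_of_isRightDescent {g : RACG Γ} (hg : g * g = 1) {b : B}
    (hmin : (racgSystem Γ).length g ≤
      (racgSystem Γ).length ((racgSystem Γ).simple b * g * (racgSystem Γ).simple b))
    (hb : (racgSystem Γ).IsRightDescent g b) : Commute ((racgSystem Γ).simple b) g := by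
  set s := (racgSystem Γ).simple b with hs
  obtain ⟨ω, hω, hw⟩ := (racgSystem Γ).exists_isReduced (s * g)
  have hinv : g⁻¹ = g := inv_eq_of_mul_eq_one_left hg
  have hlen : ω.length + 1 = (racgSystem Γ).length g := by
    rw [← hω, ← hw, ← CoxeterSystem.length_inv, mul_inv_rev, hinv, CoxeterSystem.inv_simple]
    exact (racgSystem Γ).isRightDescent_iff.mp hb
  have hg' : g = (racgSystem Γ).wordProd (b :: ω) := by
    rw [CoxeterSystem.wordProd_cons, ← hw, CoxeterSystem.simple_mul_simple_cancel_left]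
  rw [hg'] at hb
  obtain ⟨j, hj, he⟩ := exists_eraseIdx_of_isRightDescent hb
  rw [← hg', ← hs] at he
  -- Erasing the leading `b` gives `g * s = s * g`. Erasing a later letter would make `s * g * s`
  -- shorter than `g` by two, against minimality.
  cases j with
  | zero =>
    rw [List.eraseIdx_cons_zero, ← hw] at he
    exact he.symm
  | succ j =>
    rw [List.eraseIdx_cons_succ, CoxeterSystem.wordProd_cons] at he
    rw [mul_assoc, he, CoxeterSystem.simple_mul_simple_cancel_left] at hmin
    have h1 := hmin.trans ((racgSystem Γ).length_wordProd_le _)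
    have h2 := List.length_eraseIdx_add_one (l := ω) (i := j) (by simpa using hj)
    omega

/-- The last letter is a right descent, hence commutes with `g`, so moving it to the front yields
another reduced word for `g`. Rotating in this way brings each letter to the end; `ω₁` collects the
letters already moved. -/
theorem commute_of_mem_reduced {g : RACG Γ} (hg : g * g = 1)
    (hmin : ∀ b, (racgSystem Γ).length g ≤
      (racgSystem Γ).length ((racgSystem Γ).simple b * g * (racgSystem Γ).simple b))
    (ω₂ : List B) : ∀ ω₁ : List B, (racgSystem Γ).wordProd (ω₁ ++ ω₂) = g →
      (ω₁ ++ ω₂).length = (racgSystem Γ).length g → ∀ b ∈ ω₂,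
        (racgSystem Γ).IsRightDescent g b ∧ Commute ((racgSystem Γ).simple b) g := by
  induction ω₂ using List.reverseRecOn with
  | nil => simp
  | append_singleton ω₂ a ih =>
    intro ω₁ hw hl
    have hw' : (racgSystem Γ).wordProd (ω₁ ++ ω₂) * (racgSystem Γ).simple a = g := by
      rw [← hw, ← List.append_assoc, CoxeterSystem.wordProd_append _ (ω₁ ++ ω₂),
        CoxeterSystem.wordProd_singleton]
    have hd : (racgSystem Γ).IsRightDescent g a := by
      rw [CoxeterSystem.IsRightDescent]
      nth_rw 1 [← hw']
      rw [CoxeterSystem.simple_mul_simple_cancel_right, ← hl]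
      refine ((racgSystem Γ).length_wordProd_le _).trans_lt ?_
      simp
    have hc := commute_of_isRightDescent hg (hmin a) hd
    have key := ih (a :: ω₁) (by
      rw [List.cons_append, CoxeterSystem.wordProd_cons]
      have : (racgSystem Γ).wordProd (ω₁ ++ ω₂) = g * (racgSystem Γ).simple a := by
        rw [← hw', CoxeterSystem.simple_mul_simple_cancel_right]
      rw [this, ← hc.eq, CoxeterSystem.simple_mul_simple_cancel_left]) (by
        rw [← hl]; simp; omega)
    intro b hb
    rcases List.mem_append.mp hb with hb | hb
    · exact key b hb
    · rw [List.mem_singleton.mp hb]; exact ⟨hd, hc⟩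

/-- Expand both sides of `invParity (g * s) = invParity (s * g)` by the cocycle identity; the two
indicator terms agree and cancel. -/
theorem invParity_conj_of_commute {g : RACG Γ} {b : B} (h : Commute ((racgSystem Γ).simple b) g)
    (x : RACG Γ) : invParity g ((racgSystem Γ).simple b * x * (racgSystem Γ).simple b) =
      invParity g x := by
  classical
  have h1 := invParity_mul g ((racgSystem Γ).simple b) x
  rw [← h.eq, invParity_mul, CoxeterSystem.inv_simple, invParity_simple, invParity_simple] at h1
  have : g * x * g⁻¹ = (racgSystem Γ).simple b ↔ x = (racgSystem Γ).simple b := by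
    rw [mul_inv_eq_iff_eq_mul, h.eq, mul_right_inj]
  simp only [this] at h1
  rw [add_comm] at h1
  exact (add_left_cancel h1).symm

/-- If `a` and `b` generated an infinite dihedral group, conjugating `b` alternately by `b` and `a`
would give infinitely many reflections of odd parity for `g`, all in the inversion sequence of one
finite word. -/
theorem compat_of_commute {g : RACG Γ} {a b : B} (ha : Commute ((racgSystem Γ).simple a) g)
    (hb : Commute ((racgSystem Γ).simple b) g) (hd : (racgSystem Γ).IsRightDescent g b) :
    Compat Γ a b := by
  by_contra hab
  obtain ⟨ω, rfl⟩ := (racgSystem Γ).wordProd_surjective g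
  let y : ℕ → RACG Γ := fun k => ((racgSystem Γ).simple a * (racgSystem Γ).simple b) ^ k *
    (racgSystem Γ).simple b * (((racgSystem Γ).simple a * (racgSystem Γ).simple b) ^ k)⁻¹
  have hy : ∀ k, invParity ((racgSystem Γ).wordProd ω) (y k) = 1 := by
    intro k
    induction k with
    | zero => simpa [y] using invParity_simple_of_isRightDescent hd
    | succ k ih =>
      have : y (k + 1) = (racgSystem Γ).simple a * ((racgSystem Γ).simple b * y k *
          (racgSystem Γ).simple b) * (racgSystem Γ).simple a := by
        simp only [y, pow_succ', mul_inv_rev, CoxeterSystem.inv_simple, mul_assoc]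
      rw [this, invParity_conj_of_commute ha, invParity_conj_of_commute hb, ih]
  have hinj : Function.Injective y := by
    have hD : ∀ k : ℕ, toDihedral hab (y k) = .sr ((1 - 2 * (k : ℤ) : ℤ) : ZMod 0) := by
      intro k
      simp only [y, map_mul, map_inv, map_pow, toDihedral_left, toDihedral_right]
      simp only [DihedralGroup.sr_mul_sr, DihedralGroup.r_pow, DihedralGroup.inv_r,
        DihedralGroup.r_mul_sr, DihedralGroup.sr_mul_r]
      congr 1
      ring_nf
      rfl
    intro k l hkl
    have h1 := congrArg (toDihedral hab) hkl
    rw [hD, hD] at h1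
    have h2 : (1 - 2 * (k : ℤ)) = 1 - 2 * (l : ℤ) := Int.cast_injective (DihedralGroup.sr.inj h1)
    omega
  refine Set.infinite_of_injective_forall_mem hinj (s := {x | x ∈ (racgSystem Γ).rightInvSeq ω})
    (fun k => mem_rightInvSeq_of_invParity_ne_zero (by rw [hy]; simp)) (List.finite_toSet _)

/-- An element of order at most `2` is conjugate to a product of pairwise commuting generators. -/
theorem exists_isConj_wordProd {g : RACG Γ} (hg : g * g = 1) :
    ∃ ω : List B, (∀ a ∈ ω, ∀ b ∈ ω, Compat Γ a b) ∧ IsConj ((racgSystem Γ).wordProd ω) g := by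
  induction h : (racgSystem Γ).length g using Nat.strong_induction_on generalizing g with
  | _ n ih =>
    subst h
    by_cases hmin : ∀ b, (racgSystem Γ).length g ≤
        (racgSystem Γ).length ((racgSystem Γ).simple b * g * (racgSystem Γ).simple b)
    · obtain ⟨ω, hω, hw⟩ := (racgSystem Γ).exists_isReduced g
      have key := commute_of_mem_reduced hg hmin ω [] hw.symm (by rw [hw]; exact hω.symm)
      exact ⟨ω, fun a ha b hb => compat_of_commute (key a ha).2 (key b hb).2 (key b hb).1,
        hw ▸ IsConj.refl _⟩
    · push Not at hmin
      obtain ⟨b, hb⟩ := hmin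
      obtain ⟨ω, hω, hc⟩ := ih _ hb (g := (racgSystem Γ).simple b * g * (racgSystem Γ).simple b)
        (by
          have : ∀ s x : RACG Γ, s * s = 1 → x * x = 1 → s * x * s * (s * x * s) = 1 := by
            intro s x hs hx
            rw [show s * x * s * (s * x * s) = s * x * (s * s) * x * s by simp only [mul_assoc], hs,
              mul_one, mul_assoc s x x, hx, mul_one, hs]
          exact this _ _ (CoxeterSystem.simple_mul_simple_self _ _) hg) rfl
      refine ⟨ω, hω, hc.trans ?_⟩
      exact (isConj_iff.mpr ⟨(racgSystem Γ).simple b, by rw [CoxeterSystem.inv_simple]⟩).symm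

end Exchange

/-! ### Products over cliques -/

section CliqueElt

variable {B : Type*} {Γ : SimpleGraph B}

/-- A set of vertices is a clique. -/
def IsCompat (Γ : SimpleGraph B) (K : Set B) : Prop := ∀ a ∈ K, ∀ b ∈ K, Compat Γ a b

/-- The product of the generators in the support of a vector (in some order). -/
noncomputable def cliqueElt (Γ : SimpleGraph B) (x : B →₀ ZMod 2) : RACG Γ :=
  (racgSystem Γ).wordProd x.support.toList

theorem wordProd_perm {ω ω' : List B} (h : ω.Perm ω')
    (hω : ∀ a ∈ ω, ∀ b ∈ ω, Compat Γ a b) :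
    (racgSystem Γ).wordProd ω = (racgSystem Γ).wordProd ω' := by
  refine (h.map _).prod_eq' (List.pairwise_map.mpr ?_)
  exact List.pairwise_of_forall_mem_list fun a ha b hb => commute_simple (hω a ha b hb)

@[simp] theorem cliqueElt_zero : cliqueElt Γ 0 = 1 := by
  simp [cliqueElt]

@[simp] theorem cliqueElt_single (b : B) :
    cliqueElt Γ (Finsupp.single b 1) = (racgSystem Γ).simple b := by
  simp [cliqueElt]

theorem zmod_two_eq_one {z : ZMod 2} (h : z ≠ 0) : z = 1 := by
  revert z; decide

theorem cliqueElt_single_add_of_apply_eq_zero {K : Set B} (hK : IsCompat Γ K) {b : B} (hb : b ∈ K)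
    {x : B →₀ ZMod 2} (hx : ↑x.support ⊆ K) (h : x b = 0) :
    cliqueElt Γ (Finsupp.single b 1 + x) = (racgSystem Γ).simple b * cliqueElt Γ x := by
  classical
  have hb' : b ∉ x.support := by simpa using h
  have hs : (Finsupp.single b 1 + x).support = insert b x.support := by
    rw [Finsupp.support_single_add hb' one_ne_zero, Finset.cons_eq_insert]
  rw [cliqueElt, cliqueElt, ← CoxeterSystem.wordProd_cons, hs]
  refine wordProd_perm (Finset.toList_insert hb') fun a ha c hc => hK a ?_ c ?_
  · simp only [Finset.mem_toList, Finset.mem_insert] at ha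
    rcases ha with rfl | ha
    exacts [hb, hx ha]
  · simp only [Finset.mem_toList, Finset.mem_insert] at hc
    rcases hc with rfl | hc
    exacts [hb, hx hc]

theorem add_self_vector (x : B →₀ ZMod 2) : x + x = 0 := by
  ext b; exact CharTwo.add_self_eq_zero _

theorem cliqueElt_single_add {K : Set B} (hK : IsCompat Γ K) {b : B} (hb : b ∈ K)
    {x : B →₀ ZMod 2} (hx : ↑x.support ⊆ K) :
    cliqueElt Γ (Finsupp.single b 1 + x) = (racgSystem Γ).simple b * cliqueElt Γ x := by
  classical
  by_cases h : x b = 0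
  · exact cliqueElt_single_add_of_apply_eq_zero hK hb hx h
  -- Here adding `b` removes it from the support, so the previous case applies to the sum, and the
  -- generator is cancelled.
  · have hy := cliqueElt_single_add_of_apply_eq_zero hK hb (x := Finsupp.single b 1 + x) (by
      intro a ha
      rcases Finset.mem_union.mp (Finsupp.support_add ha) with ha | ha
      · rw [Finsupp.support_single _ one_ne_zero, Finset.mem_singleton] at ha
        exact ha ▸ hb
      · exact hx ha) (by
        rw [Finsupp.add_apply, Finsupp.single_eq_same, zmod_two_eq_one h, CharTwo.add_self_eq_zero])
    rw [← add_assoc, add_self_vector, zero_add] at hy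
    rw [hy, CoxeterSystem.simple_mul_simple_cancel_left]

theorem mem_supported_iff {K : Set B} {x : B →₀ ZMod 2} :
    x ∈ Finsupp.supported (ZMod 2) (ZMod 2) K ↔ ↑x.support ⊆ K := Iff.rfl

/-- Induction over the vectors supported in a set. -/
theorem supported_induction {K : Set B} {p : (B →₀ ZMod 2) → Prop} (zero : p 0)
    (single_add : ∀ b ∈ K, ∀ x ∈ Finsupp.supported (ZMod 2) (ZMod 2) K, p x →
      p (Finsupp.single b 1 + x)) {x : B →₀ ZMod 2}
    (hx : x ∈ Finsupp.supported (ZMod 2) (ZMod 2) K) : p x := by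
  induction x using Finsupp.induction with
  | zero => exact zero
  | single_add b z x hb hz ih =>
    obtain rfl := zmod_two_eq_one hz
    rw [mem_supported_iff, Finsupp.support_single_add hb one_ne_zero, Finset.coe_cons,
      Set.insert_subset_iff] at hx
    exact single_add b hx.1 x hx.2 (ih hx.2)

theorem cliqueElt_add {K : Set B} (hK : IsCompat Γ K) {x y : B →₀ ZMod 2}
    (hx : x ∈ Finsupp.supported (ZMod 2) (ZMod 2) K)
    (hy : y ∈ Finsupp.supported (ZMod 2) (ZMod 2) K) :
    cliqueElt Γ (x + y) = cliqueElt Γ x * cliqueElt Γ y := by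
  refine supported_induction (p := fun x => cliqueElt Γ (x + y) = cliqueElt Γ x * cliqueElt Γ y)
    (by simp) (fun b hb x hx ih => ?_) hx
  rw [add_assoc, cliqueElt_single_add hK hb (add_mem hx hy), cliqueElt_single_add hK hb hx, ih,
    mul_assoc]

theorem cliqueElt_mul_self {K : Set B} (hK : IsCompat Γ K) {x : B →₀ ZMod 2}
    (hx : x ∈ Finsupp.supported (ZMod 2) (ZMod 2) K) : cliqueElt Γ x * cliqueElt Γ x = 1 := by
  rw [← cliqueElt_add hK hx hx, add_self_vector, cliqueElt_zero]

theorem exists_cliqueElt_eq_wordProd {ω : List B} (hω : ∀ a ∈ ω, ∀ b ∈ ω, Compat Γ a b) :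
    ∃ x : B →₀ ZMod 2, IsCompat Γ x.support ∧ cliqueElt Γ x = (racgSystem Γ).wordProd ω := by
  suffices h : ∀ ω' : List B, (∀ a ∈ ω', a ∈ ω) →
      ∃ x ∈ Finsupp.supported (ZMod 2) (ZMod 2) {a | a ∈ ω},
        cliqueElt Γ x = (racgSystem Γ).wordProd ω' by
    obtain ⟨x, hx, h⟩ := h ω fun _ => id
    exact ⟨x, fun a ha b hb => hω a (hx ha) b (hx hb), h⟩
  intro ω' h
  induction ω' with
  | nil => exact ⟨0, zero_mem _, by simp⟩
  | cons b ω' ih =>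
    obtain ⟨x, hx, he⟩ := ih fun a ha => h a (List.mem_cons_of_mem _ ha)
    have hb := h b List.mem_cons_self
    refine ⟨Finsupp.single b 1 + x, add_mem (Finsupp.single_mem_supported _ _ hb) hx, ?_⟩
    rw [cliqueElt_single_add hω hb hx, he, CoxeterSystem.wordProd_cons]

/-- An element of order at most `2` is conjugate to the product over a clique. -/
theorem exists_isConj_cliqueElt {g : RACG Γ} (hg : g * g = 1) :
    ∃ x : B →₀ ZMod 2, IsCompat Γ x.support ∧ IsConj (cliqueElt Γ x) g := by
  obtain ⟨ω, hω, hc⟩ := exists_isConj_wordProd hg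
  obtain ⟨x, hx, he⟩ := exists_cliqueElt_eq_wordProd hω
  exact ⟨x, hx, he ▸ hc⟩

/-! ### The abelianization -/

/-- The homomorphism from `W_Γ` to the vector space on the vertices. -/
noncomputable def toVector (Γ : SimpleGraph B) : RACG Γ →* Multiplicative (B →₀ ZMod 2) :=
  (racgSystem Γ).lift ⟨fun b => Multiplicative.ofAdd (Finsupp.single b 1), isLiftable_raMatrix
    (fun _ => congrArg Multiplicative.ofAdd (add_self_vector _)) (fun _ _ _ => Commute.all _ _)⟩

theorem toVector_simple (b : B) : toVector Γ ((racgSystem Γ).simple b) =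
    Multiplicative.ofAdd (Finsupp.single b 1) :=
  (racgSystem Γ).lift_apply_simple _ b

theorem linearCombination_toVector (g : RACG Γ) :
    Finsupp.linearCombination (ZMod 2)
      (fun b => Additive.ofMul (Abelianization.of ((racgSystem Γ).simple b)))
      (toVector Γ g).toAdd = Additive.ofMul (Abelianization.of g) := by
  induction g using (racgSystem Γ).simple_induction with
  | simple b => rw [toVector_simple, toAdd_ofAdd, Finsupp.linearCombination_single, one_smul]
  | one => rw [map_one, toAdd_one, map_zero, map_one, ofMul_one]
  | mul g h hg hh => rw [map_mul, toAdd_mul, map_add, hg, hh, map_mul, ofMul_mul]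

/-- The abelianization of `W_Γ` is the vector space on the vertices. -/
noncomputable def abEquiv (Γ : SimpleGraph B) :
    Additive (Abelianization (RACG Γ)) ≃ₗ[ZMod 2] (B →₀ ZMod 2) :=
  LinearEquiv.ofLinearMap
    (AddMonoidHom.toZModLinearMap 2 (MonoidHom.toAdditiveLeft (Abelianization.lift (toVector Γ))))
    (Finsupp.linearCombination (ZMod 2)
      (fun b => Additive.ofMul (Abelianization.of ((racgSystem Γ).simple b))))
    (by
      ext b : 2
      simp [toVector_simple])
    (LinearMap.ext fun x => by
      obtain ⟨g, hg⟩ := QuotientGroup.mk_surjective (Additive.toMul x)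
      obtain rfl : Additive.ofMul (Abelianization.of g) = x := hg
      exact linearCombination_toVector g)

theorem abEquiv_of (g : RACG Γ) :
    abEquiv Γ (Additive.ofMul (Abelianization.of g)) = (toVector Γ g).toAdd := rfl

/-- The order of the factors is lost in the abelian target. This is what makes a clique product
recoverable from its image. -/
theorem toVector_cliqueElt (x : B →₀ ZMod 2) :
    toVector Γ (cliqueElt Γ x) = Multiplicative.ofAdd x := by
  classical
  rw [cliqueElt, CoxeterSystem.wordProd, map_list_prod, List.map_map]
  have : (toVector Γ ∘ (racgSystem Γ).simple) =
    fun b => Multiplicative.ofAdd (Finsupp.single b 1) := funext toVector_simple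
  rw [this, Finset.prod_map_toList, ← ofAdd_sum]
  congr 1
  conv_rhs => rw [← Finsupp.sum_single x, Finsupp.sum]
  exact Finset.sum_congr rfl fun b hb => by rw [zmod_two_eq_one (Finsupp.mem_support_iff.mp hb)]

theorem orderOf_cliqueElt {x : B →₀ ZMod 2} (hx : IsCompat Γ x.support) (h0 : x ≠ 0) :
    orderOf (cliqueElt Γ x) = 2 := by
  refine orderOf_eq_prime (by rw [pow_two]; exact cliqueElt_mul_self hx (mem_supported_iff.mpr subset_rfl)) fun h => h0 ?_
  have := toVector_cliqueElt (Γ := Γ) x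
  rw [h, map_one] at this
  exact (Multiplicative.ofAdd.injective this).symm

/-! ### Classes of involutions -/

/-- The vector of a class of involutions. -/
noncomputable def classVector (v : InvClass (RACG Γ)) : B →₀ ZMod 2 := abEquiv Γ (abImage v)

theorem abImage_eq {v : InvClass (RACG Γ)} {g : RACG Γ} (h : ConjClasses.mk g = v.1) :
    abImage v = Additive.ofMul (Abelianization.of g) := by
  rw [abImage, ← h]; rfl

theorem classVector_eq {v : InvClass (RACG Γ)} {g : RACG Γ} (h : ConjClasses.mk g = v.1) :
    classVector v = (toVector Γ g).toAdd := by
  rw [classVector, abImage_eq h, abEquiv_of]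

/-- The vector is a conjugacy invariant, so the clique product conjugate to a representative can
only be that of the class vector. -/
theorem classVector_spec (v : InvClass (RACG Γ)) :
    IsCompat Γ (classVector v).support ∧ classVector v ≠ 0 ∧
      ConjClasses.mk (cliqueElt Γ (classVector v)) = v.1 := by
  obtain ⟨g, hg, hv⟩ := v.2
  obtain ⟨x, hx, hc⟩ := exists_isConj_cliqueElt (g := g) (by
    rw [← pow_two, ← hg, pow_orderOf_eq_one])
  have hm : ConjClasses.mk (cliqueElt Γ x) = v.1 := by
    rw [← hv]; exact ConjClasses.mk_eq_mk_iff_isConj.mpr hc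
  have he : classVector v = x := by rw [classVector_eq hm, toVector_cliqueElt]; rfl
  rw [he]
  refine ⟨hx, ?_, hm⟩
  rintro rfl
  rw [cliqueElt_zero] at hc
  rw [isConj_one_right.mp hc, orderOf_one] at hg
  exact absurd hg (by norm_num)

theorem classVector_injective : Function.Injective (classVector (Γ := Γ)) := fun u v h =>
  Subtype.ext (by rw [← (classVector_spec u).2.2, h, (classVector_spec v).2.2])

/-- The class of the product over a non-empty clique. -/
noncomputable def cliqueClass {x : B →₀ ZMod 2} (hx : IsCompat Γ x.support) (h0 : x ≠ 0) :
    InvClass (RACG Γ) :=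
  ⟨ConjClasses.mk (cliqueElt Γ x), cliqueElt Γ x, orderOf_cliqueElt hx h0, rfl⟩

theorem classVector_cliqueClass {x : B →₀ ZMod 2} (hx : IsCompat Γ x.support) (h0 : x ≠ 0) :
    classVector (cliqueClass hx h0) = x := by
  rw [classVector_eq (g := cliqueElt Γ x) rfl, toVector_cliqueElt]; rfl

/-! ### Adjacency of classes of involutions -/

theorem cliqueElt_commute {K L : Set B} (h : ∀ a ∈ K, ∀ b ∈ L, Compat Γ a b) {x y : B →₀ ZMod 2}
    (hx : ↑x.support ⊆ K) (hy : ↑y.support ⊆ L) : Commute (cliqueElt Γ x) (cliqueElt Γ y) := by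
  refine Commute.list_prod_left _ _ fun g hg => Commute.list_prod_right _ _ fun g' hg' => ?_
  obtain ⟨a, ha, rfl⟩ := List.mem_map.mp hg
  obtain ⟨b, hb, rfl⟩ := List.mem_map.mp hg'
  exact commute_simple (h a (hx (Finset.mem_toList.mp ha)) b (hy (Finset.mem_toList.mp hb)))

/-- A clique contains at most one of the two non-adjacent vertices, so every letter other than `c`
is killed. -/
theorem toDihedral_cliqueElt {a b c : B} (h : ¬ Compat Γ a b) {x : B →₀ ZMod 2}
    (hx : IsCompat Γ x.support) (hc : c ∈ x.support) (hc' : c = a ∨ c = b) :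
    toDihedral h (cliqueElt Γ x) = toDihedral h ((racgSystem Γ).simple c) := by
  classical
  have h1 := cliqueElt_single_add hx hc (x := x) subset_rfl
  rw [← (racgSystem Γ).simple_mul_simple_cancel_left (w := cliqueElt Γ x) c, ← h1, map_mul]
  -- The remaining factor is the product over the support with `c` removed.
  convert mul_one _
  rw [cliqueElt, CoxeterSystem.wordProd, map_list_prod, List.map_map]
  refine List.prod_eq_one fun g hg => ?_
  obtain ⟨d, hd, rfl⟩ := List.mem_map.mp hg
  rw [Finset.mem_toList, Finsupp.mem_support_iff, Finsupp.add_apply] at hd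
  have hdc : d ≠ c := by
    rintro rfl
    rw [Finsupp.single_eq_same, zmod_two_eq_one (Finsupp.mem_support_iff.mp hc)] at hd
    exact hd (CharTwo.add_self_eq_zero _)
  rw [Finsupp.single_eq_of_ne hdc, zero_add, ← Finsupp.mem_support_iff] at hd
  have hcd := hx c hc d hd
  refine toDihedral_of_ne h ?_ ?_
  · rintro rfl
    rcases hc' with rfl | rfl
    exacts [hdc rfl, h hcd.symm]
  · rintro rfl
    rcases hc' with rfl | rfl
    exacts [h hcd, hdc rfl]

/-- The parity of the index of a reflection is a conjugacy invariant in the infinite dihedral group.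
-/
theorem dihedral_conj_sr (g : DihedralGroup 0) (i : ZMod 0) :
    ∃ j : ZMod 0, g * .sr i * g⁻¹ = .sr (i + 2 * j) := by
  rcases g with k | k
  · refine ⟨-k, ?_⟩
    simp only [DihedralGroup.inv_r, DihedralGroup.r_mul_sr, DihedralGroup.sr_mul_r]
    congr 1; ring
  · refine ⟨k - i, ?_⟩
    simp only [DihedralGroup.inv_sr, DihedralGroup.r_mul_sr, DihedralGroup.sr_mul_sr]
    congr 1; ring

/-- Otherwise `g` and `h` map to reflections of even and odd index. Commuting reflections `sr m`,
`sr n` satisfy `n - m = m - n`, and `ZMod 0` is `ℤ`, so the indices would coincide. -/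
theorem compat_of_commute_conj {x y : B →₀ ZMod 2} (hx : IsCompat Γ x.support)
    (hy : IsCompat Γ y.support) {g h : RACG Γ} (hg : IsConj (cliqueElt Γ x) g)
    (hh : IsConj (cliqueElt Γ y) h) (hgh : Commute g h) {a b : B} (ha : a ∈ x.support)
    (hb : b ∈ y.support) : Compat Γ a b := by
  have key : ∀ i j : ℤ, ¬ (1 + 2 * j - (0 + 2 * i) = 0 + 2 * i - (1 + 2 * j)) := by omega
  by_contra hab
  obtain ⟨u, rfl⟩ := isConj_iff.mp hg
  obtain ⟨v, rfl⟩ := isConj_iff.mp hh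
  have hc := hgh.map (toDihedral hab)
  simp only [map_mul, map_inv] at hc
  rw [toDihedral_cliqueElt hab hx ha (Or.inl rfl), toDihedral_cliqueElt hab hy hb (Or.inr rfl),
    toDihedral_left, toDihedral_right] at hc
  obtain ⟨i, hi⟩ := dihedral_conj_sr (toDihedral hab u) 0
  obtain ⟨j, hj⟩ := dihedral_conj_sr (toDihedral hab v) 1
  rw [hi, hj] at hc
  have h1 := hc.eq
  rw [DihedralGroup.sr_mul_sr, DihedralGroup.sr_mul_sr] at h1
  exact absurd (DihedralGroup.r.inj h1) (key i j)

theorem mem_vertexStar_iff {u v : InvClass (RACG Γ)} :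
    u ∈ vertexStar (invGraph (RACG Γ)) v ↔
      ∀ a ∈ (classVector u).support, ∀ b ∈ (classVector v).support, Compat Γ a b := by
  obtain ⟨hu, -, hu'⟩ := classVector_spec u
  obtain ⟨hv, -, hv'⟩ := classVector_spec v
  constructor
  · rintro (rfl | ⟨-, g, h, hg, hh, hgh⟩)
    · exact hu
    · intro a ha b hb
      refine (compat_of_commute_conj hv hu ?_ ?_ hgh hb ha).symm
      · rw [← ConjClasses.mk_eq_mk_iff_isConj, hv', hg]
      · rw [← ConjClasses.mk_eq_mk_iff_isConj, hu', hh]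
  · intro h
    by_cases huv : u = v
    · exact Or.inl huv
    · exact Or.inr ⟨Ne.symm huv, _, _, hv', hu',
        (cliqueElt_commute h subset_rfl subset_rfl).symm⟩

end CliqueElt

/-! ### The star poset of the involution graph -/

section Star

variable {B : Type*} {Γ : SimpleGraph B}

theorem isCompat_support_single (b : B) :
    IsCompat Γ (Finsupp.single b (1 : ZMod 2)).support := by
  classical
  rw [Finsupp.support_single _ one_ne_zero, Finset.coe_singleton]
  rintro a rfl c rfl
  exact Or.inl rfl

/-- The class of a generator. -/
noncomputable def simpleClass (Γ : SimpleGraph B) (b : B) : InvClass (RACG Γ) :=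
  cliqueClass (isCompat_support_single b) (Finsupp.single_ne_zero.mpr one_ne_zero)

@[simp] theorem classVector_simpleClass (b : B) :
    classVector (simpleClass Γ b) = Finsupp.single b 1 :=
  classVector_cliqueClass _ _

theorem simpleClass_injective : Function.Injective (simpleClass Γ) := fun a b h => by
  have := congrArg classVector h
  rw [classVector_simpleClass, classVector_simpleClass] at this
  exact Finsupp.single_left_injective one_ne_zero this

/-- The star class of a generator. -/
noncomputable def vertexClass (Γ : SimpleGraph B) (b : B) : StarPoset (invGraph (RACG Γ)) :=
  starClass _ (simpleClass Γ b)

/-- The clique of `Γ` below a star class. -/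
def baseClique (c : StarPoset (invGraph (RACG Γ))) : Set B := {b | c ≤ vertexClass Γ b}

theorem mem_vertexStar_simpleClass {u : InvClass (RACG Γ)} {b : B} :
    u ∈ vertexStar (invGraph (RACG Γ)) (simpleClass Γ b) ↔
      ∀ a ∈ (classVector u).support, Compat Γ a b := by
  classical
  simp [mem_vertexStar_iff, Finsupp.support_single]

theorem starClass_le_starClass {V : Type*} {G : SimpleGraph V} {u v : V} :
    starClass G u ≤ starClass G v ↔ vertexStar G u ⊆ vertexStar G v := Iff.rfl

/-- The star of a class is the intersection of the stars of the generators in its support. -/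
theorem le_starClass_iff {c : StarPoset (invGraph (RACG Γ))} {v : InvClass (RACG Γ)} :
    c ≤ starClass _ v ↔ ↑(classVector v).support ⊆ baseClique c := by
  induction c using Quotient.inductionOn with
  | _ w =>
  change starClass _ w ≤ _ ↔ ∀ ⦃b⦄, _ → starClass _ w ≤ starClass _ (simpleClass Γ b)
  simp only [starClass_le_starClass]
  constructor
  · intro h b hb u hu
    exact mem_vertexStar_simpleClass.mpr fun a ha => mem_vertexStar_iff.mp (h hu) a ha b hb
  · intro h u hu
    exact mem_vertexStar_iff.mpr fun a ha b hb => mem_vertexStar_simpleClass.mp (h hb hu) a ha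

theorem support_subset_baseClique (v : InvClass (RACG Γ)) :
    ↑(classVector v).support ⊆ baseClique (starClass _ v) :=
  le_starClass_iff.mp le_rfl

theorem mem_baseClique_vertexClass (b : B) : b ∈ baseClique (vertexClass Γ b) :=
  le_refl (vertexClass Γ b)

theorem mem_vertexStar_self {V : Type*} (G : SimpleGraph V) (v : V) : v ∈ vertexStar G v :=
  Set.mem_insert _ _

theorem mem_vertexStar_comm {V : Type*} {G : SimpleGraph V} {u v : V} :
    u ∈ vertexStar G v ↔ v ∈ vertexStar G u := by
  simp [vertexStar, eq_comm, SimpleGraph.adj_comm]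

/-- If the stars of `u` and `v` are contained in those of `u'` and `v'`, and `u` and `v` are
compatible, then so are `u'` and `v'`. -/
theorem mem_vertexStar_of_subset {V : Type*} {G : SimpleGraph V} {u v u' v' : V}
    (h : u ∈ vertexStar G v) (hu : vertexStar G u ⊆ vertexStar G u')
    (hv : vertexStar G v ⊆ vertexStar G v') : u' ∈ vertexStar G v' :=
  hv (mem_vertexStar_comm.mp (hu (mem_vertexStar_comm.mp h)))

theorem compat_iff_mem_vertexStar {a b : B} :
    Compat Γ a b ↔ simpleClass Γ a ∈ vertexStar (invGraph (RACG Γ)) (simpleClass Γ b) := by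
  classical
  simp [mem_vertexStar_simpleClass, Finsupp.support_single]

/-- Enlarging stars preserves compatibility. This ensures that `cliqueHom` respects the commutation
relations. -/
theorem compat_of_mem_baseClique {a b a' b' : B} (h : Compat Γ a b)
    (ha : a' ∈ baseClique (vertexClass Γ a)) (hb : b' ∈ baseClique (vertexClass Γ b)) :
    Compat Γ a' b' :=
  compat_iff_mem_vertexStar.mpr (mem_vertexStar_of_subset (compat_iff_mem_vertexStar.mp h) ha hb)

theorem isCompat_baseClique (c : StarPoset (invGraph (RACG Γ))) :
    IsCompat Γ (baseClique c) := by
  induction c using Quotient.inductionOn with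
  | _ w =>
  intro a ha b hb
  exact compat_iff_mem_vertexStar.mpr
    (mem_vertexStar_of_subset (mem_vertexStar_self _ w) ha hb)

theorem classVector_mem_supported {c : StarPoset (invGraph (RACG Γ))} {v : InvClass (RACG Γ)} :
    v ∈ cliqueAbove c ↔ classVector v ∈ Finsupp.supported (ZMod 2) (ZMod 2) (baseClique c) :=
  le_starClass_iff

theorem cliqueAbove_anti {V : Type*} {G : SimpleGraph V} {c d : StarPoset G} (h : c ≤ d) :
    cliqueAbove d ⊆ cliqueAbove c := fun _ hv => h.trans hv

theorem baseClique_anti {c d : StarPoset (invGraph (RACG Γ))} (h : c ≤ d) :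
    baseClique d ⊆ baseClique c := fun _ hb => h.trans hb

/-- Every non-zero vector supported in the clique `baseClique c` has clique support, hence comes
from a class of involutions. -/
theorem image_classVector_cliqueAbove (c : StarPoset (invGraph (RACG Γ))) :
    insert 0 (classVector '' cliqueAbove c) =
      (Finsupp.supported (ZMod 2) (ZMod 2) (baseClique c) : Set (B →₀ ZMod 2)) := by
  ext x
  constructor
  · rintro (rfl | ⟨v, hv, rfl⟩)
    · exact zero_mem _
    · exact classVector_mem_supported.mp hv
  · intro hx
    by_cases h0 : x = 0
    · exact Or.inl h0
    · have hc : IsCompat Γ x.support :=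
        fun a ha b hb => isCompat_baseClique c a (hx ha) b (hx hb)
      refine Or.inr ⟨cliqueClass hc h0, ?_, classVector_cliqueClass _ _⟩
      rw [classVector_mem_supported, classVector_cliqueClass]
      exact hx

end Star

/-! ### Dimension counts -/

section Dimension

variable {B : Type*} {Γ : SimpleGraph B}

instance [Finite B] : Finite (B →₀ ZMod 2) := Module.finite_of_finite (ZMod 2)

theorem finrank_supported [Finite B] (Y : Set B) :
    Module.finrank (ZMod 2) (Finsupp.supported (ZMod 2) (ZMod 2) Y) = Y.ncard := by
  have := Fintype.ofFinite Y
  rw [(Finsupp.supportedEquivFinsupp Y).finrank_eq, Module.finrank_finsupp_self,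
    ← Nat.card_eq_fintype_card, Nat.card_coe_set_eq]

theorem encard_cliqueAbove [Finite B] (c : StarPoset (invGraph (RACG Γ))) :
    (cliqueAbove c).encard + 1 = 2 ^ (baseClique c).ncard := by
  have h0 : (0 : B →₀ ZMod 2) ∉ classVector '' cliqueAbove c := by
    rintro ⟨v, -, hv⟩
    exact (classVector_spec v).2.1 hv
  rw [← classVector_injective.encard_image, ← Set.encard_insert_of_notMem h0,
    image_classVector_cliqueAbove, ← Set.Finite.cast_ncard_eq (Set.toFinite _),
    ← Nat.card_coe_set_eq]
  have := Module.natCard_eq_pow_finrank (K := ZMod 2)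
    (V := Finsupp.supported (ZMod 2) (ZMod 2) (baseClique c))
  rw [finrank_supported, Nat.card_zmod] at this
  exact_mod_cast this

instance [Finite B] : Finite (InvClass (RACG Γ)) := Finite.of_injective _ classVector_injective

instance [Finite B] : Finite (StarPoset (invGraph (RACG Γ))) := Quotient.finite _

theorem supported_le_iff {Y : Set B} {p : Submodule (ZMod 2) (B →₀ ZMod 2)} :
    Finsupp.supported (ZMod 2) (ZMod 2) Y ≤ p ↔ ∀ b ∈ Y, Finsupp.single b 1 ∈ p := by
  rw [Finsupp.supported_eq_span_single, Submodule.span_le, Set.image_subset_iff]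
  rfl

theorem finrank_span_image [Finite B] {X : Set (InvClass (RACG Γ))}
    (h : LinearIndepOn (ZMod 2) classVector X) :
    Module.finrank (ZMod 2) (Submodule.span (ZMod 2) (classVector '' X)) = X.ncard := by
  have := Fintype.ofFinite X
  rw [Set.image_eq_range, finrank_span_eq_card h, ← Nat.card_eq_fintype_card, Nat.card_coe_set_eq]

/-- The span of `X` has dimension at least `Y.ncard`, so `X` has no more elements than the dimension
of its span. -/
theorem linearIndepOn_of_supported_le_span [Finite B] {X : Set (InvClass (RACG Γ))} {Y : Set B}
    (h : Finsupp.supported (ZMod 2) (ZMod 2) Y ≤ Submodule.span (ZMod 2) (classVector '' X))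
    (hc : X.ncard ≤ Y.ncard) : LinearIndepOn (ZMod 2) classVector X := by
  have := Fintype.ofFinite X
  refine linearIndependent_iff_card_le_finrank_span.mpr ?_
  rw [← Nat.card_eq_fintype_card, Nat.card_coe_set_eq, Set.finrank, ← Set.image_eq_range]
  exact hc.trans ((finrank_supported Y).ge.trans (Submodule.finrank_mono h))

theorem ncard_eq_of_supported_le_span [Finite B] {X : Set (InvClass (RACG Γ))} {Y : Set B}
    (hi : LinearIndepOn (ZMod 2) classVector X)
    (hX : ∀ v ∈ X, ↑(classVector v).support ⊆ Y)
    (h : Finsupp.supported (ZMod 2) (ZMod 2) Y ≤ Submodule.span (ZMod 2) (classVector '' X)) :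
    X.ncard = Y.ncard := by
  have : Submodule.span (ZMod 2) (classVector '' X) = Finsupp.supported (ZMod 2) (ZMod 2) Y := by
    refine le_antisymm (Submodule.span_le.mpr ?_) h
    rintro _ ⟨v, hv, rfl⟩
    exact hX v hv
  rw [← finrank_span_image hi, ← finrank_supported, this]

theorem supported_le_span_of_ncard_eq [Finite B] {X : Set (InvClass (RACG Γ))} {Y : Set B}
    (hi : LinearIndepOn (ZMod 2) classVector X)
    (hX : ∀ v ∈ X, ↑(classVector v).support ⊆ Y) (hc : X.ncard = Y.ncard) :
    Finsupp.supported (ZMod 2) (ZMod 2) Y ≤ Submodule.span (ZMod 2) (classVector '' X) := by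
  refine (Submodule.eq_of_le_of_finrank_eq (Submodule.span_le.mpr ?_) ?_).ge
  · rintro _ ⟨v, hv, rfl⟩
    exact hX v hv
  · rw [finrank_span_image hi, finrank_supported, hc]

end Dimension

/-! ### The invariants of the collapsing procedure -/

section Invariants

variable {B : Type*} {Γ : SimpleGraph B}

/-- The vertices of `Γ` whose star class is `c`. -/
def verticesOf (c : StarPoset (invGraph (RACG Γ))) : Set B := {b | vertexClass Γ b = c}

/-- The vertices of `Γ` whose star class has been considered. -/
def CollapseState.consideredVertices (s : CollapseState (invGraph (RACG Γ))) : Set B :=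
  {b | vertexClass Γ b ∈ s.considered}

/-- The properties of the states that are reached by the collapsing procedure with independent
choices. -/
structure CollapseState.IsGood (s : CollapseState (invGraph (RACG Γ))) : Prop where
  chosen_considered : ∀ v ∈ s.chosen, starClass _ v ∈ s.considered
  isUpperSet : IsUpperSet s.considered
  -- Only chosen vertices above `c` are used, so the property passes to the clique above any smaller
  -- class.
  supported_le_span : ∀ c ∈ s.considered, Finsupp.supported (ZMod 2) (ZMod 2) (baseClique c) ≤
    Submodule.span (ZMod 2) (classVector '' (cliqueAbove c ∩ s.chosen))
  ncard_class : ∀ c ∈ s.considered,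
    {v ∈ s.chosen | starClass _ v = c}.ncard = (verticesOf c).ncard
  indep : LinearIndepOn (ZMod 2) classVector s.chosen

variable {s : CollapseState (invGraph (RACG Γ))}

theorem verticesOf_subset_baseClique (c : StarPoset (invGraph (RACG Γ))) :
    verticesOf c ⊆ baseClique c := fun _ hb => le_of_eq (Eq.symm hb)

theorem CollapseState.IsGood.initial : (CollapseState.initial (invGraph (RACG Γ))).IsGood where
  chosen_considered _ hv := hv.elim
  isUpperSet _ _ _ h := h.elim
  supported_le_span _ hc := hc.elim
  ncard_class _ hc := hc.elim
  indep := linearIndepOn_empty _ _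

theorem CollapseState.IsGood.supported_consideredVertices (hs : s.IsGood) :
    Finsupp.supported (ZMod 2) (ZMod 2) s.consideredVertices ≤
      Submodule.span (ZMod 2) (classVector '' s.chosen) :=
  supported_le_iff.mpr fun b hb =>
    Submodule.span_mono (Set.image_mono Set.inter_subset_right) (hs.supported_le_span _ hb
      (Finsupp.single_mem_supported _ _ (mem_baseClique_vertexClass b)))

theorem CollapseState.IsGood.support_subset (hs : s.IsGood) {v : InvClass (RACG Γ)}
    (hv : v ∈ s.chosen) : ↑(classVector v).support ⊆ s.consideredVertices := fun _ hb =>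
  hs.isUpperSet (support_subset_baseClique v hb) (hs.chosen_considered v hv)

theorem CollapseState.IsGood.ncard_chosen [Finite B] (hs : s.IsGood) :
    s.chosen.ncard = s.consideredVertices.ncard :=
  ncard_eq_of_supported_le_span hs.indep (fun _ => hs.support_subset)
    hs.supported_consideredVertices

/-- This computes `k'`. A considered `b` in `baseClique w` lies in the span of the chosen vertices
above its own class, and these are also above `w`. -/
theorem CollapseState.IsGood.ncard_cliqueAbove_inter [Finite B] (hs : s.IsGood)
    (w : StarPoset (invGraph (RACG Γ))) :
    (cliqueAbove w ∩ s.chosen).ncard = (baseClique w ∩ s.consideredVertices).ncard := by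
  refine ncard_eq_of_supported_le_span (hs.indep.mono Set.inter_subset_right)
    (fun v hv => Set.subset_inter (le_starClass_iff.mp hv.1) (hs.support_subset hv.2))
    (supported_le_iff.mpr fun b hb => ?_)
  exact Submodule.span_mono (Set.image_mono (Set.inter_subset_inter_left _ (cliqueAbove_anti hb.1)))
    (hs.supported_le_span _ hb.2
      (Finsupp.single_mem_supported _ _ (mem_baseClique_vertexClass b)))

theorem CollapseState.IsNext.disjoint {w : StarPoset (invGraph (RACG Γ))} (hw : s.IsNext w) :
    Disjoint s.consideredVertices (verticesOf w) :=
  Set.disjoint_left.mpr fun b hb hb' => hw.1 (by rw [← show vertexClass Γ b = w from hb']; exact hb)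

theorem CollapseState.IsNext.ncard_baseClique [Finite B] {w : StarPoset (invGraph (RACG Γ))}
    (hw : s.IsNext w) : (baseClique w).ncard =
      (baseClique w ∩ s.consideredVertices).ncard + (verticesOf w).ncard := by
  rw [← Set.ncard_union_eq (hw.disjoint.mono_left Set.inter_subset_right)]
  congr 1
  ext b
  constructor
  · intro hb
    rcases eq_or_lt_of_le (show w ≤ vertexClass Γ b from hb) with h | h
    · exact Or.inr h.symm
    · exact Or.inl ⟨hb, hw.2 _ h⟩
  · rintro (hb | hb)
    exacts [hb.1, verticesOf_subset_baseClique w hb]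

theorem CollapseState.IsGood.isChoice_iff [Finite B] (hs : s.IsGood) {w : StarPoset (invGraph (RACG Γ))}
    (hw : s.IsNext w) {C : Set (InvClass (RACG Γ))} :
    s.IsChoice w C ↔ (∀ v ∈ C, starClass _ v = w) ∧ C.ncard = (verticesOf w).ncard := by
  refine and_congr_right fun _ => ?_
  have h1 := hs.ncard_cliqueAbove_inter w
  have h2 := hw.ncard_baseClique
  have h3 : ∀ k : ℕ, (cliqueAbove w).encard + 1 = 2 ^ k ↔ k = (baseClique w).ncard := by
    intro k
    rw [encard_cliqueAbove]
    constructor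
    · intro h
      exact (Nat.pow_right_injective le_rfl (by exact_mod_cast h)).symm
    · rintro rfl; rfl
  have h4 : ∀ k : ℕ, (cliqueAbove w ∩ s.chosen).encard + C.encard = k ↔
      (cliqueAbove w ∩ s.chosen).ncard + C.ncard = k := by
    intro k
    rw [← Set.Finite.cast_ncard_eq (Set.toFinite _), ← Set.Finite.cast_ncard_eq (Set.toFinite C)]
    norm_cast
  simp only [h3, h4, exists_eq_left]
  omega

/-- The enlarged set spans the coordinate space of the considered vertices and those of class `w`,
and has at most as many elements as its dimension. -/
theorem CollapseState.IsGood.linearIndepOn_union [Finite B] (hs : s.IsGood)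
    {w : StarPoset (invGraph (RACG Γ))} (hw : s.IsNext w) {C : Set (InvClass (RACG Γ))}
    (hC : C.ncard = (verticesOf w).ncard)
    (h : ∀ b ∈ verticesOf w, Finsupp.single b 1 ∈
      Submodule.span (ZMod 2) (classVector '' (s.chosen ∪ C))) :
    LinearIndepOn (ZMod 2) classVector (s.chosen ∪ C) := by
  refine linearIndepOn_of_supported_le_span (Y := s.consideredVertices ∪ verticesOf w)
    (supported_le_iff.mpr ?_) ?_
  · rintro b (hb | hb)
    · exact Submodule.span_mono (Set.image_mono Set.subset_union_left)
        (hs.supported_consideredVertices (Finsupp.single_mem_supported _ _ hb))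
    · exact h b hb
  · rw [Set.ncard_union_eq hw.disjoint, ← hs.ncard_chosen, ← hC]
    exact Set.ncard_union_le _ _

theorem CollapseState.IsGood.exists_choice [Finite B] (hs : s.IsGood) {w : StarPoset (invGraph (RACG Γ))}
    (hw : s.IsNext w) :
    ∃ C, s.IsChoice w C ∧ LinearIndepOn (ZMod 2) classVector (s.chosen ∪ C) := by
  have hC := Set.ncard_image_of_injective (verticesOf w) (simpleClass_injective (Γ := Γ))
  -- The classes of the standard generators of star class `w` are always a valid choice, whatever
  -- was chosen before.
  refine ⟨simpleClass Γ '' verticesOf w, (hs.isChoice_iff hw).mpr ⟨?_, hC⟩,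
    hs.linearIndepOn_union hw hC fun b hb => ?_⟩
  · rintro _ ⟨b, hb, rfl⟩
    exact hb
  · rw [← classVector_simpleClass (Γ := Γ)]
    exact Submodule.subset_span ⟨_, Or.inr ⟨b, hb, rfl⟩, rfl⟩

theorem CollapseState.IsGood.update [Finite B] (hs : s.IsGood) {w : StarPoset (invGraph (RACG Γ))}
    (hw : s.IsNext w) {C : Set (InvClass (RACG Γ))} (hC : s.IsChoice w C)
    (hi : LinearIndepOn (ZMod 2) classVector (cliqueAbove w ∩ (s.chosen ∪ C))) :
    (s.update w C).IsGood := by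
  rw [hs.isChoice_iff hw] at hC
  obtain ⟨hCw, hC⟩ := hC
  have hdisj : Disjoint s.chosen C := Set.disjoint_left.mpr fun v hv hv' =>
    hw.1 (hCw v hv' ▸ hs.chosen_considered v hv)
  have hCa : C ⊆ cliqueAbove w := fun v hv => (hCw v hv).ge
  -- The independent family in the clique above `w` has `k' + (k - k') = k` members, the dimension
  -- of the coordinate subspace, so it spans.
  have hspan : Finsupp.supported (ZMod 2) (ZMod 2) (baseClique w) ≤
      Submodule.span (ZMod 2) (classVector '' (cliqueAbove w ∩ (s.chosen ∪ C))) := by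
    refine supported_le_span_of_ncard_eq hi (fun v hv => le_starClass_iff.mp hv.1) ?_
    rw [Set.inter_union_distrib_left, Set.inter_eq_right.mpr hCa,
      Set.ncard_union_eq (hdisj.mono_left Set.inter_subset_right), hs.ncard_cliqueAbove_inter, hC,
      hw.ncard_baseClique]
  refine ⟨?_, ?_, ?_, ?_, ?_⟩
  · rintro v (hv | hv)
    exacts [Or.inr (hs.chosen_considered v hv), Or.inl (hCw v hv)]
  · rintro c d hcd (rfl | hc)
    · rcases eq_or_lt_of_le hcd with rfl | h
      exacts [Or.inl rfl, Or.inr (hw.2 d h)]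
    · exact Or.inr (hs.isUpperSet hcd hc)
  · rintro c (rfl | hc)
    · exact hspan
    · exact (hs.supported_le_span c hc).trans (Submodule.span_mono
        (Set.image_mono (Set.inter_subset_inter_right _ Set.subset_union_left)))
  · rintro c (rfl | hc)
    · rw [← hC]
      congr 1
      ext v
      constructor
      · rintro ⟨hv | hv, h⟩
        exacts [(hw.1 (h ▸ hs.chosen_considered v hv)).elim, hv]
      · exact fun hv => ⟨Or.inr hv, hCw v hv⟩
    · rw [← hs.ncard_class c hc]
      congr 1
      ext v
      constructor
      · rintro ⟨hv | hv, h⟩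
        exacts [⟨hv, h⟩, (hw.1 (by rw [← hCw v hv, h]; exact hc)).elim]
      · exact fun hv => ⟨Or.inl hv.1, hv.2⟩
  · exact hs.linearIndepOn_union hw hC fun b hb =>
      Submodule.span_mono (Set.image_mono Set.inter_subset_right)
        (hspan (Finsupp.single_mem_supported _ _ (verticesOf_subset_baseClique w hb)))

theorem linearIndepOn_abImage_iff {X : Set (InvClass (RACG Γ))} :
    LinearIndepOn (ZMod 2) abImage X ↔ LinearIndepOn (ZMod 2) classVector X :=
  (LinearMap.linearIndependent_iff (abEquiv Γ).toLinearMap (abEquiv Γ).ker).symm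

theorem IndepStep.isGood [Finite B] {t : CollapseState (invGraph (RACG Γ))} (hs : s.IsGood)
    (h : IndepStep Γ s t) : t.IsGood := by
  obtain ⟨w, C, hw, hC, hi, rfl⟩ := h
  exact hs.update hw hC (linearIndepOn_abImage_iff.mp hi)

theorem IndepReachable.isGood [Finite B] (h : IndepReachable Γ s) : s.IsGood := by
  induction h with
  | refl => exact CollapseState.IsGood.initial
  | tail _ hst ih => exact hst.isGood ih

theorem CollapseState.exists_isNext [Finite B] (h : ¬ s.IsFinal) : ∃ w, s.IsNext w := by
  have hne : s.consideredᶜ.Nonempty := Set.nonempty_compl.mpr h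
  obtain ⟨w, hw⟩ := (Set.toFinite s.consideredᶜ).exists_maximal hne
  exact ⟨w, hw.prop, fun v hv => not_not.mp fun hv' => hw.not_gt hv' hv⟩

theorem CollapseState.IsGood.exists_final [Finite B] (hs : s.IsGood) :
    ∃ t, Relation.ReflTransGen (IndepStep Γ) s t ∧ t.IsFinal := by
  induction h : s.consideredᶜ.ncard using Nat.strong_induction_on generalizing s with
  | _ n ih =>
    by_cases hf : s.IsFinal
    · exact ⟨s, .refl, hf⟩
    · obtain ⟨w, hw⟩ := CollapseState.exists_isNext hf
      obtain ⟨C, hC, hi⟩ := hs.exists_choice hw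
      have hst : IndepStep Γ s (s.update w C) := ⟨w, C, hw, hC,
        linearIndepOn_abImage_iff.mpr (hi.mono Set.inter_subset_right), rfl⟩
      obtain ⟨t, ht, htf⟩ := ih _ (by
        rw [← h]
        refine Set.ncard_lt_ncard ⟨Set.compl_subset_compl.mpr (Set.subset_insert _ _), fun h' => ?_⟩
        exact h' hw.1 (Set.mem_insert _ _)) (hst.isGood hs) rfl
      exact ⟨t, .head hst ht, htf⟩

/-- Elements with linearly independent images in the abelianization satisfy no non-trivial
product relation. -/
theorem not_hasProductRelation {X : Set (InvClass (RACG Γ))}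
    (hX : LinearIndepOn (ZMod 2) abImage X) {r : InvClass (RACG Γ) → RACG Γ}
    (hr : ∀ v, ConjClasses.mk (r v) = v.1) : ¬ HasProductRelation r X := by
  classical
  rintro ⟨L, hL, ⟨v, hv⟩, hprod⟩
  have hvX : v ∈ X := hL v (List.count_pos_iff.mp hv.pos)
  have h1 : (L.map abImage).sum = 0 := by
    have := congrArg (fun g => Additive.ofMul (Abelianization.of g)) hprod
    simp only [map_list_prod, List.map_map, map_one, ofMul_one, ofMul_list_prod] at this
    rw [← this]
    congr 1
    exact List.map_congr_left fun u _ => abImage_eq (hr u)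
  -- Multiplicities modulo 2 become coefficients; the odd one at `v` is non-zero.
  have h2 : ∑ u ∈ L.toFinset, (L.count u : ZMod 2) • abImage u = 0 := by
    rw [← h1, Finset.sum_list_map_count]
    exact Finset.sum_congr rfl fun u _ => Nat.cast_smul_eq_nsmul _ _ _
  have h3 := linearIndepOn_iff'.mp hX L.toFinset (fun u => (L.count u : ZMod 2))
    (fun u hu => hL u (List.mem_toFinset.mp hu)) h2 v
    (List.mem_toFinset.mpr (List.count_pos_iff.mp hv.pos))
  rw [ZMod.natCast_eq_zero_iff_even] at h3
  exact (Nat.not_even_iff_odd.mpr hv) h3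

end Invariants

/-! ### Automorphisms that act linearly on the cliques -/

section Automorphism

variable {B : Type*} {Γ : SimpleGraph B}

/-- A linear map respects the cliques if it sends every vertex into the clique of its class. -/
def RespectsCliques (Γ : SimpleGraph B) (M : (B →₀ ZMod 2) →ₗ[ZMod 2] (B →₀ ZMod 2)) : Prop :=
  ∀ b, M (Finsupp.single b 1) ∈
    Finsupp.supported (ZMod 2) (ZMod 2) (baseClique (vertexClass Γ b))

theorem RespectsCliques.supported_le_comap {M : (B →₀ ZMod 2) →ₗ[ZMod 2] (B →₀ ZMod 2)}
    (hM : RespectsCliques Γ M) (c : StarPoset (invGraph (RACG Γ))) :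
    Finsupp.supported (ZMod 2) (ZMod 2) (baseClique c) ≤
      (Finsupp.supported (ZMod 2) (ZMod 2) (baseClique c)).comap M :=
  supported_le_iff.mpr fun b hb => Finsupp.supported_mono (baseClique_anti hb) (hM b)

/-- An injective linear map of a finite-dimensional coordinate subspace into itself is onto, so the
inverse preserves the subspace too. -/
theorem RespectsCliques.symm [Finite B] {M : (B →₀ ZMod 2) ≃ₗ[ZMod 2] (B →₀ ZMod 2)}
    (hM : RespectsCliques Γ M.toLinearMap) : RespectsCliques Γ M.symm.toLinearMap := by
  intro b
  set p := Finsupp.supported (ZMod 2) (ZMod 2) (baseClique (vertexClass Γ b)) with hp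
  have hle : p.map M.toLinearMap ≤ p := Submodule.map_le_iff_le_comap.mpr (hM.supported_le_comap _)
  have heq : p.map M.toLinearMap = p :=
    Submodule.eq_of_le_of_finrank_eq hle (LinearEquiv.finrank_map_eq M p)
  have hb : Finsupp.single b 1 ∈ p.map M.toLinearMap := by
    rw [heq]
    exact Finsupp.single_mem_supported _ _ (mem_baseClique_vertexClass b)
  obtain ⟨x, hx, hxb⟩ := hb
  rw [← hxb]
  simpa using hx

/-- The endomorphism of `W_Γ` that acts on the clique subgroups by a linear map. -/
noncomputable def cliqueHom {M : (B →₀ ZMod 2) →ₗ[ZMod 2] (B →₀ ZMod 2)}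
    (hM : RespectsCliques Γ M) : RACG Γ →* RACG Γ :=
  (racgSystem Γ).lift ⟨fun b => cliqueElt Γ (M (Finsupp.single b 1)), isLiftable_raMatrix
    (fun b => cliqueElt_mul_self (isCompat_baseClique _) (hM b))
    (fun a b hab => cliqueElt_commute (fun _ ha _ hb =>
      compat_of_mem_baseClique (Or.inr hab) ha hb) (hM a) (hM b))⟩

theorem cliqueHom_simple {M : (B →₀ ZMod 2) →ₗ[ZMod 2] (B →₀ ZMod 2)}
    (hM : RespectsCliques Γ M) (b : B) :
    cliqueHom hM ((racgSystem Γ).simple b) = cliqueElt Γ (M (Finsupp.single b 1)) :=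
  (racgSystem Γ).lift_apply_simple _ b

/-- On a single clique, `cliqueElt` turns sums into products, so agreement on generators suffices.
This makes `cliqueHom` compatible with composition. -/
theorem cliqueHom_cliqueElt {M : (B →₀ ZMod 2) →ₗ[ZMod 2] (B →₀ ZMod 2)}
    (hM : RespectsCliques Γ M) {c : StarPoset (invGraph (RACG Γ))} {x : B →₀ ZMod 2}
    (hx : x ∈ Finsupp.supported (ZMod 2) (ZMod 2) (baseClique c)) :
    cliqueHom hM (cliqueElt Γ x) = cliqueElt Γ (M x) := by
  refine supported_induction (p := fun x => cliqueHom hM (cliqueElt Γ x) = cliqueElt Γ (M x))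
    (by simp) (fun b hb x hx ih => ?_) hx
  rw [cliqueElt_single_add (isCompat_baseClique c) hb hx, map_mul, ih, cliqueHom_simple, map_add,
    cliqueElt_add (isCompat_baseClique c)
      (hM.supported_le_comap c (Finsupp.single_mem_supported _ _ hb))
      (hM.supported_le_comap c hx)]

theorem cliqueHom_comp {M N : (B →₀ ZMod 2) →ₗ[ZMod 2] (B →₀ ZMod 2)}
    (hM : RespectsCliques Γ M) (hN : RespectsCliques Γ N) (h : ∀ x, N (M x) = x) :
    (cliqueHom hN).comp (cliqueHom hM) = MonoidHom.id _ :=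
  (racgSystem Γ).ext_simple fun b => by
    rw [MonoidHom.comp_apply, cliqueHom_simple, cliqueHom_cliqueElt hN (hM b), h, cliqueElt_single,
      MonoidHom.id_apply]

/-- The automorphism of `W_Γ` that acts on the clique subgroups by a linear automorphism. -/
noncomputable def cliqueEquiv [Finite B] {M : (B →₀ ZMod 2) ≃ₗ[ZMod 2] (B →₀ ZMod 2)}
    (hM : RespectsCliques Γ M.toLinearMap) : RACG Γ ≃* RACG Γ :=
  (cliqueHom hM).toMulEquiv (cliqueHom hM.symm)
    (cliqueHom_comp hM hM.symm M.symm_apply_apply) (cliqueHom_comp hM.symm hM M.apply_symm_apply)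

theorem cliqueEquiv_simple [Finite B] {M : (B →₀ ZMod 2) ≃ₗ[ZMod 2] (B →₀ ZMod 2)}
    (hM : RespectsCliques Γ M.toLinearMap) (b : B) :
    cliqueEquiv hM ((racgSystem Γ).simple b) = cliqueElt Γ (M (Finsupp.single b 1)) :=
  cliqueHom_simple hM b

/-- A Coxeter system of type `Γ` can be reindexed along a bijection of the vertices. -/
theorem exists_coxeterSystem_comap {C W : Type*} [Group W] (e : B ≃ C)
    (cs : CoxeterSystem (raMatrix Γ) W) :
    ∃ cs' : CoxeterSystem (raMatrix (Γ.comap e.symm)) W,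
      ∀ c, cs'.simple c = cs.simple (e.symm c) := by
  have h : (raMatrix Γ).reindex e = raMatrix (Γ.comap e.symm) := by
    ext i j
    by_cases hij : i = j
    · simp [raMatrix, CoxeterMatrix.reindex, hij]
    · by_cases ha : Γ.Adj (e.symm i) (e.symm j) <;>
        simp [raMatrix, CoxeterMatrix.reindex, hij, ha]
  rw [← h]
  exact ⟨cs.reindex e, fun c => cs.reindex_simple e c⟩

end Automorphism

/-! ### The final states -/

section Final

variable {B : Type*} {Γ : SimpleGraph B} {s : CollapseState (invGraph (RACG Γ))}

theorem CollapseState.IsGood.span_classVector_eq_top (hs : s.IsGood) (hf : s.IsFinal) :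
    Submodule.span (ZMod 2) (classVector '' s.chosen) = ⊤ := by
  have h : s.consideredVertices = Set.univ :=
    Set.eq_univ_of_forall fun b => by
      rw [CollapseState.consideredVertices, show s.considered = Set.univ from hf]
      exact Set.mem_univ _
  have := hs.supported_consideredVertices
  rwa [h, Finsupp.supported_univ, top_le_iff] at this

theorem CollapseState.IsGood.span_abImage_eq_top (hs : s.IsGood) (hf : s.IsFinal) :
    Submodule.span (ZMod 2) (abImage '' s.chosen) = ⊤ := by
  have h := hs.span_classVector_eq_top hf
  have h1 : classVector '' s.chosen = (abEquiv Γ).toLinearMap '' (abImage '' s.chosen) := by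
    rw [Set.image_image]; rfl
  rw [h1, Submodule.span_image] at h
  exact Submodule.map_injective_of_injective (abEquiv Γ).injective
    (h.trans (LinearEquiv.range (abEquiv Γ) ▸ (Submodule.map_top _).symm))

/-- By `ncard_class` the fibres over each star class have equal size; bijections between them are
glued. -/
theorem CollapseState.IsGood.exists_equiv [Finite B] (hs : s.IsGood) (hf : s.IsFinal) :
    ∃ e : B ≃ s.chosen, ∀ b, starClass _ (e b).1 = vertexClass Γ b := by
  have h : ∀ c : StarPoset (invGraph (RACG Γ)),
      Nonempty ({b // vertexClass Γ b = c} ≃ {v : s.chosen // starClass _ v.1 = c}) := by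
    intro c
    have hc := hs.ncard_class c (by rw [show s.considered = Set.univ from hf]; exact Set.mem_univ _)
    obtain ⟨e⟩ := Finite.card_eq.mp (hc.symm : Nat.card (verticesOf c) =
      Nat.card {v // v ∈ s.chosen ∧ starClass _ v = c})
    exact ⟨e.trans (Equiv.subtypeSubtypeEquivSubtypeInter _ _).symm⟩
  exact ⟨Equiv.ofFiberEquiv (f := vertexClass Γ) (g := fun v : s.chosen => starClass _ v.1)
    fun c => (h c).some, Equiv.ofFiberEquiv_map (f := vertexClass Γ)
      (g := fun v : s.chosen => starClass _ v.1) fun c => (h c).some⟩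

theorem CollapseState.IsGood.exists_coxeterSystem [Finite B] (hs : s.IsGood) (hf : s.IsFinal) :
    ∃ (Λ : SimpleGraph s.chosen) (cs : CoxeterSystem (raMatrix Λ) (RACG Γ)),
      ∀ v : s.chosen, ConjClasses.mk (cs.simple v) = v.1.1 := by
  obtain ⟨e, he⟩ := hs.exists_equiv hf
  have hli : LinearIndependent (ZMod 2) (fun b => classVector (e b).1) :=
    LinearIndependent.comp hs.indep e e.injective
  have hspan : ⊤ ≤ Submodule.span (ZMod 2) (Set.range fun b => classVector (e b).1) := by
    rw [← hs.span_classVector_eq_top hf]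
    refine Submodule.span_mono ?_
    rintro _ ⟨v, hv, rfl⟩
    exact ⟨e.symm ⟨v, hv⟩, by simp⟩
  -- The change of basis from the standard vectors to the chosen ones. It respects cliques because
  -- `e` preserves star classes.
  let M : (B →₀ ZMod 2) ≃ₗ[ZMod 2] (B →₀ ZMod 2) := (Module.Basis.mk hli hspan).repr.symm
  have hM : ∀ b, M (Finsupp.single b 1) = classVector (e b).1 := fun b => by
    rw [Module.Basis.repr_symm_single_one, Module.Basis.mk_apply]
  have hMr : RespectsCliques Γ M.toLinearMap := fun b => by
    rw [LinearEquiv.coe_coe, hM, ← he]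
    exact support_subset_baseClique _
  obtain ⟨cs, hcs⟩ := exists_coxeterSystem_comap e ((racgSystem Γ).map (cliqueEquiv hMr))
  refine ⟨_, cs, fun v => ?_⟩
  rw [hcs, CoxeterSystem.map_simple, cliqueEquiv_simple, hM, e.apply_symm_apply]
  exact (classVector_spec v.1).2.2

end Final

theorem mainTheorem9 {B : Type*} [Finite B] (Γ : SimpleGraph B) :
    -- step 2 can always be carried out with linearly independent images
    (∀ s, IndepReachable Γ s → ∀ w, s.IsNext w →
      ∃ C, s.IsChoice w C ∧ LinearIndepOn (ZMod 2) abImage (s.chosen ∪ C)) ∧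
    -- and every such run can be completed
    (∀ s, IndepReachable Γ s → ∃ t, Relation.ReflTransGen (IndepStep Γ) s t ∧ t.IsFinal) ∧
    -- at every stage of such a run there are no relations between the chosen elements
    (∀ s, IndepReachable Γ s →
      LinearIndepOn (ZMod 2) abImage s.chosen ∧
      ∀ r : InvClass (RACG Γ) → RACG Γ, (∀ v, ConjClasses.mk (r v) = v.1) →
        ¬ HasProductRelation r s.chosen) ∧
    -- at the end, the chosen set is the image of a right-angled Coxeter generating set
    (∀ s, IndepReachable Γ s → s.IsFinal →
      Submodule.span (ZMod 2) (abImage '' s.chosen) = ⊤ ∧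
      ∃ (Λ : SimpleGraph s.chosen) (cs : CoxeterSystem (raMatrix Λ) (RACG Γ)),
        ∀ v : s.chosen, ConjClasses.mk (cs.simple v) = v.1.1 ∧
          Additive.ofMul (Abelianization.of (cs.simple v)) = abImage v.1) := by
  refine ⟨fun s hs w hw => ?_, fun s hs => hs.isGood.exists_final, fun s hs => ?_,
    fun s hs hf => ⟨hs.isGood.span_abImage_eq_top hf, ?_⟩⟩
  · obtain ⟨C, hC, hi⟩ := hs.isGood.exists_choice hw
    exact ⟨C, hC, linearIndepOn_abImage_iff.mpr hi⟩
  · have hi := linearIndepOn_abImage_iff.mpr hs.isGood.indep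
    exact ⟨hi, fun r hr => not_hasProductRelation hi hr⟩
  · obtain ⟨Λ, cs, h⟩ := hs.isGood.exists_coxeterSystem hf
    exact ⟨Λ, cs, fun v => ⟨h v, (abImage_eq (h v)).symm⟩⟩
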